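/- Let $X$ be a real or complex Banach space and $T$ a bounded linear operator on $X$, with null space $\mathcal N(T)$ and range $\mathcal R(T)$. Definitions. A bounded operator $S$ on a normed space $Y$ is *upper semi-Fredholm* if $\mathcal R(S)$ is closed and $\dim\mathcal N(S)<\infty$, and *lower semi-Fredholm* if $\dim Y/\mathcal R(S)<\infty$; it is *semi-Fredholm* if it is one of the two, and then its index is $\operatorname{ind}(S)=\dim\mathcal N(S)-\dim Y/\mathcal R(S)\in\mathbb Z\cup\{\pm\infty\}$. It is *left essentially invertible* if it is upper semi-Fredholm and $\mathcal R(S)$ is topologically complemented in $Y$, and *right essentially invertible* if it is lower semi-Fredholm and $\mathcal N(S)$ is topologically complemented in $Y$. Let $\operatorname{dis}(T)$ be the least integer $n\ge 0$ such that $\mathcal N(T)\cap\mathcal R(T^m)=\mathcal N(T)\cap\mathcal R(T^n)$ for all $m\ge n$ (and $\operatorname{dis}(T)=\infty$ if there is none). $T$ is *left B-Fredholm* if $d:=\operatorname{dis}(T)<\infty$, $\dim[\mathcal N(T)\cap\mathcal R(T^d)]<\infty$ and $\mathcal R(T)+\mathcal N(T^d)$ is topologically complemented in $X$; $T$ is *right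 B-Fredholm* if $d:=\operatorname{dis}(T)<\infty$, $\mathcal R(T)+\mathcal N(T^d)$ is closed of finite codimension and $\mathcal N(T)\cap\mathcal R(T^d)$ is topologically complemented in $X$. If there is an $n\ge 0$ such that $\mathcal R(T^n)$ is closed and $T|_{\mathcal R(T^n)}$ is semi-Fredholm, the (B-Fredholm) index of $T$ is $\operatorname{ind}(T):=\operatorname{ind}(T|_{\mathcal R(T^n)})$ for any such $n$. Closed subspaces $M,N$ of $X$ *reduce* $T$ if $X=M\oplus N$, $T(M)\subseteq M$ and $T(N)\subseteq N$. Theorem. (i) $T$ is left B-Fredholm if and only if there are closed subspaces $M$ and $N$ of $X$ reducing $T$ such that $T|_M$ is left essentially invertible and $T|_N$ is nilpotent. Moreover, for all such $M$ and $N$, the index of $T$ is defined, does not depend on the choice of $n$, and $\operatorname{ind}(T)=\operatorname{ind}(T|_M)$. (ii) $T$ is right B-Fredholm if and only if there are closed subspaces $M$ and $N$ of $X$ reducing $T$ such that $T|_M$ is right essentially invertible and $T|_N$ is nilpotent. Moreover, for all such $M$ and $N$, the index of $T$ is defined, does not depend on the choice of $n$, and $\operatorname{ind}(T)=\operatorname{ind}(T|_M)$.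 -/

import Mathlib

open scoped ENNReal

namespace BFredholm

section Fredholm

variable {𝕜 : Type*} [RCLike 𝕜] {Y : Type*} [NormedAddCommGroup Y] [NormedSpace 𝕜 Y]

/-- Upper semi Fredholm: closed range and finite-dimensional kernel. -/
structure IsUpperSemiFredholm (S : Y →L[𝕜] Y) : Prop where
  isClosed_range : IsClosed (S.range : Set Y)
  finite_ker : FiniteDimensional 𝕜 S.ker

/-- Lower semi Fredholm: range of finite codimension. -/
structure IsLowerSemiFredholm (S : Y →L[𝕜] Y) : Prop where
  finite_coker : FiniteDimensional 𝕜 (Y ⧸ S.range)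

/-- Left essentially invertible (left Fredholm): upper semi Fredholm with topologically
complemented range. -/
structure IsLeftEssInvertible (S : Y →L[𝕜] Y) : Prop where
  upper : IsUpperSemiFredholm S
  compl_range : S.range.ClosedComplemented

/-- Right essentially invertible (right Fredholm): lower semi Fredholm with topologically
complemented kernel. -/
structure IsRightEssInvertible (S : Y →L[𝕜] Y) : Prop where
  lower : IsLowerSemiFredholm S
  compl_ker : S.ker.ClosedComplemented

/-- The dimension of a vector space as an extended real number (`⊤` if infinite). -/
noncomputable def edim (𝕜 V : Type*) [DivisionRing 𝕜] [AddCommGroup V] [Module 𝕜 V] : EReal :=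
  (((Cardinal.toENat (Module.rank 𝕜 V) : ℕ∞) : ℝ≥0∞) : EReal)

/-- `ind S = dim N(S) - dim Y / R(S)`, with values in `[-∞, ∞]`. It is only used for operators
for which at least one of the two dimensions is finite. -/
noncomputable def fredholmIndex (S : Y →L[𝕜] Y) : EReal :=
  edim 𝕜 S.ker - edim 𝕜 (Y ⧸ S.range)

end Fredholm

section BFredholm

variable {𝕜 : Type*} [RCLike 𝕜] {X : Type*} [NormedAddCommGroup X] [NormedSpace 𝕜 X]

/-- The set of `n` such that `N(T) ∩ R(T^m) = N(T) ∩ R(T^n)` for all `m ≥ n`. -/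
def stableSet (T : X →L[𝕜] X) : Set ℕ :=
  {n | ∀ m, n ≤ m → T.ker ⊓ (T ^ n).range = T.ker ⊓ (T ^ m).range}

/-- The degree of stable iteration `dis T` (`⊤` if `stableSet T` is empty). -/
noncomputable def dis (T : X →L[𝕜] X) : ℕ∞ :=
  ⨅ n ∈ stableSet T, (n : ℕ∞)

/-- Left B-Fredholm: `d = dis T` is finite, `N(T) ∩ R(T^d)` is finite-dimensional and
`R(T) + N(T^d)` is topologically complemented. -/
def IsLeftBFredholm (T : X →L[𝕜] X) : Prop :=
  ∃ d : ℕ, dis T = d ∧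
    FiniteDimensional 𝕜 (T.ker ⊓ (T ^ d).range : Submodule 𝕜 X) ∧
    (T.range ⊔ (T ^ d).ker).ClosedComplemented

/-- Right B-Fredholm: `d = dis T` is finite, `R(T) + N(T^d)` is closed of finite codimension and
`N(T) ∩ R(T^d)` is topologically complemented. -/
def IsRightBFredholm (T : X →L[𝕜] X) : Prop :=
  ∃ d : ℕ, dis T = d ∧
    IsClosed ((T.range ⊔ (T ^ d).ker : Submodule 𝕜 X) : Set X) ∧
    FiniteDimensional 𝕜 (X ⧸ (T.range ⊔ (T ^ d).ker)) ∧
    (T.ker ⊓ (T ^ d).range).ClosedComplemented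

theorem map_mem_range_pow (T : X →L[𝕜] X) (n : ℕ) :
    ∀ x ∈ (T ^ n).range, T x ∈ (T ^ n).range := by
  rintro _ ⟨y, rfl⟩
  refine ⟨T y, ?_⟩
  change (T ^ n * T) y = (T * T ^ n) y
  rw [← pow_succ, ← pow_succ']

/-- The restriction of `T` to the range of `T ^ n`. -/
def restrictRange (T : X →L[𝕜] X) (n : ℕ) : (T ^ n).range →L[𝕜] (T ^ n).range :=
  T.restrict (map_mem_range_pow T n)

/-- `n` witnesses that `T` is semi B-Fredholm: `R(T^n)` is closed and the restriction of `T` to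
it is upper or lower semi Fredholm. -/
def IsSemiBFredholmAt (T : X →L[𝕜] X) (n : ℕ) : Prop :=
  IsClosed ((T ^ n).range : Set X) ∧
    (IsUpperSemiFredholm (restrictRange T n) ∨ IsLowerSemiFredholm (restrictRange T n))

/-- `k` is the index of the semi B-Fredholm operator `T`: the operator is semi B-Fredholm, and
the index of its restriction to `R(T^n)` is `k` for every `n` for which `R(T^n)` is closed and
this restriction is semi Fredholm. At most one `k` has this property. -/
def HasBFredholmIndex (T : X →L[𝕜] X) (k : EReal) : Prop :=
  (∃ n, IsSemiBFredholmAt T n) ∧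
    ∀ n, IsSemiBFredholmAt T n → fredholmIndex (restrictRange T n) = k

/-- The closed subspaces `M` and `N` reduce `T`: `X = M ⊕ N` and both are `T`-invariant. -/
structure Reduces (T : X →L[𝕜] X) (M N : Submodule 𝕜 X) : Prop where
  isClosed_left : IsClosed (M : Set X)
  isClosed_right : IsClosed (N : Set X)
  isCompl : IsCompl M N
  map_left : ∀ x ∈ M, T x ∈ M
  map_right : ∀ x ∈ N, T x ∈ N

end BFredholm

end BFredholm

/-! The forward directions rest on a Kato decomposition (`exists_kato_decomposition`). Let `d` be
stable, `Z` a closed complement of `R(T) + N(T^d)` and `P` a projection onto `N(T) ∩ R(T^d)`. Take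
`M = Z + TZ + ⋯ + T^(d-1)Z + R(T^d)` and `N = {x ∈ N(T^d) : P T^j x = 0 for j < d}`. Stability
forces `M ∩ N(T^m) ⊆ R(T^d)` and `N(T^d) ⊆ R(T^d) + N`, and `R(T^d) ∩ N = 0`, so `X = M ⊕ N`
algebraically. `M` is closed because it is an operator range with a closed complement. Kernel and
range of `T|_M` are the traces on `M` of `N(T) ∩ R(T^d)` and `R(T) + N(T^d)`.

Conversely, once `T^m` kills `N`, the spaces `N(T) ∩ R(T^m)` and `R(T) + N(T^m)` are read off from
`T|_M`, and stability carries them back to `d = dis T`.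

For the index, `T` on `R(T^n)` and on `R(T^(n+1))` are the two compositions of an inclusion and a
surjection, so nullity and defect drop by the same amount (`exists_erank_comp_swap`). -/

namespace BFredholm

/-! ### Extended dimensions and their differences -/

section Rank

variable {K : Type*} [DivisionRing K] {V W : Type*} [AddCommGroup V] [Module K V]
  [AddCommGroup W] [Module K W]

/-- The dimension of a vector space as an extended natural number. -/
noncomputable def erank (K V : Type*) [DivisionRing K] [AddCommGroup V] [Module K V] : ℕ∞ :=
  Cardinal.toENat (Module.rank K V)

theorem erank_ne_top_iff : erank K V ≠ ⊤ ↔ FiniteDimensional K V := by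
  rw [erank, Cardinal.toENat_ne_top, Module.rank_lt_aleph0_iff]

/-- The difference of two extended natural numbers, as an extended real number. -/
noncomputable def ediff (x y : ℕ∞) : EReal := ((x : ℝ≥0∞) : EReal) - ((y : ℝ≥0∞) : EReal)

/-- Finiteness of `a` is essential: `⊤ - ⊤` is a fixed default value in `EReal`, unrelated to `x`
and `y`. -/
theorem ediff_add_left {a x y : ℕ∞} (ha : a ≠ ⊤) : ediff (a + x) (a + y) = ediff x y := by
  lift a to ℕ using ha
  have key : ∀ n : ℕ, (((n : ℕ∞) : ℝ≥0∞) : EReal) = ((n : ℝ) : EReal) := fun n => by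
    rw [ENat.toENNReal_coe]
    rfl
  unfold ediff
  induction x using ENat.recTopCoe with
  | top =>
    induction y using ENat.recTopCoe with
    | top => simp
    | coe y =>
      rw [← Nat.cast_add, key, key]
      simp only [add_top, ENat.toENNReal_top, EReal.coe_ennreal_top, EReal.top_sub_coe]
  | coe x =>
    induction y using ENat.recTopCoe with
    | top =>
      rw [← Nat.cast_add, key, key]
      simp only [add_top, ENat.toENNReal_top, EReal.coe_ennreal_top, EReal.sub_top]
    | coe y =>
      rw [← Nat.cast_add, ← Nat.cast_add, key, key, key, key, ← EReal.coe_sub, ← EReal.coe_sub]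
      congr 1
      push_cast
      ring

end Rank

section RankUniverse

universe u
variable {K : Type*} [DivisionRing K] {V W : Type u} [AddCommGroup V] [Module K V]
  [AddCommGroup W] [Module K W]

theorem erank_congr (e : V ≃ₗ[K] W) : erank K V = erank K W := by
  rw [erank, erank, e.rank_eq]

theorem erank_eq_add_ker_of_surjective (f : V →ₗ[K] W) (hf : Function.Surjective f) :
    erank K V = erank K W + erank K f.ker := by
  rw [erank, LinearMap.rank_eq_of_surjective hf, map_add]
  rfl

theorem erank_congr_of_eq {p q : Submodule K V} (h : p = q) : erank K p = erank K q := by rw [h]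

theorem erank_map_of_injective (f : V →ₗ[K] W) (hf : Function.Injective f) (p : Submodule K V) :
    erank K (p.map f) = erank K p :=
  (erank_congr (p.equivMapOfInjective f hf)).symm

/-- The two compositions of an injective map `ι` and a surjective map `σ` have kernels and
cokernels whose dimensions differ by the same amount. -/
theorem exists_erank_comp_swap (ι : W →ₗ[K] V) (σ : V →ₗ[K] W) (hι : Function.Injective ι)
    (hσ : Function.Surjective σ) :
    ∃ a : ℕ∞, erank K (ι ∘ₗ σ).ker = a + erank K (σ ∘ₗ ι).ker ∧
      erank K (V ⧸ (ι ∘ₗ σ).range) = a + erank K (W ⧸ (σ ∘ₗ ι).range) := by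
  -- The common excess is the dimension of `(ker σ + range ι) / range ι`. It is the quotient of `ker
  -- σ` by `ker σ ∩ range ι ≅ ker (σ ∘ ι)`, and also the kernel of the surjection `V / range ι → W /
  -- σ(range ι)`.
  refine ⟨erank K (σ.ker.map ι.range.mkQ), ?_, ?_⟩
  · have h1 : (ι ∘ₗ σ).ker = σ.ker := LinearMap.ker_comp_of_ker_eq_bot _ (LinearMap.ker_eq_bot.2 hι)
    rw [h1, erank_eq_add_ker_of_surjective (ι.range.mkQ.submoduleMap σ.ker)
      (LinearMap.submoduleMap_surjective _ _)]
    congr 1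
    rw [← erank_map_of_injective ι hι, ← erank_map_of_injective _ σ.ker.injective_subtype]
    refine erank_congr_of_eq ?_
    · ext x
      simp only [Submodule.mem_map, LinearMap.mem_ker, LinearMap.comp_apply]
      constructor
      · rintro ⟨y, hy, rfl⟩
        have := congrArg Subtype.val hy
        obtain ⟨w, hw⟩ : (y : V) ∈ ι.range := by simpa using this
        exact ⟨w, by rw [hw]; exact y.2, hw⟩
      · rintro ⟨w, hw, rfl⟩
        exact ⟨⟨ι w, hw⟩, Subtype.ext (by simp), rfl⟩
  · have h1 : (ι ∘ₗ σ).range = ι.range := LinearMap.range_comp_of_range_eq_top _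
      (LinearMap.range_eq_top.2 hσ)
    have h2 : (σ ∘ₗ ι).range = ι.range.map σ := LinearMap.range_comp _ _
    rw [h1, h2, erank_eq_add_ker_of_surjective
      (ι.range.mapQ (ι.range.map σ) σ (Submodule.le_comap_map _ _)), add_comm]
    · congr 1
      refine erank_congr_of_eq ?_
      rw [Submodule.mapQ, Submodule.ker_liftQ, LinearMap.ker_comp, Submodule.ker_mkQ,
        Submodule.comap_map_eq, Submodule.map_sup]
      simp
    · rw [← LinearMap.range_eq_top, Submodule.range_mapQ, LinearMap.range_eq_top.2 hσ]
      simp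

end RankUniverse

/-! ### Index of the restrictions to `R(T^n)` -/

section Index

universe u
variable {𝕜 : Type*} [RCLike 𝕜] {X Y : Type u} [NormedAddCommGroup X] [NormedSpace 𝕜 X]
  [NormedAddCommGroup Y] [NormedSpace 𝕜 Y]

theorem fredholmIndex_eq_ediff (S : X →L[𝕜] X) :
    fredholmIndex S = ediff (erank 𝕜 S.ker) (erank 𝕜 (X ⧸ S.range)) := rfl

theorem erank_ker_congr {S : X →L[𝕜] X} {S' : Y →L[𝕜] Y} (e : X ≃ₗ[𝕜] Y)
    (h : ∀ x, e (S x) = S' (e x)) : erank 𝕜 S.ker = erank 𝕜 S'.ker := by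
  rw [← erank_map_of_injective e.toLinearMap e.injective]
  refine erank_congr_of_eq ?_
  ext y
  obtain ⟨x, rfl⟩ := e.surjective y
  simp [← h]

theorem erank_coker_congr {S : X →L[𝕜] X} {S' : Y →L[𝕜] Y} (e : X ≃ₗ[𝕜] Y)
    (h : ∀ x, e (S x) = S' (e x)) : erank 𝕜 (X ⧸ S.range) = erank 𝕜 (Y ⧸ S'.range) := by
  refine erank_congr (Submodule.Quotient.equiv _ _ e ?_)
  ext y
  simp only [Submodule.mem_map, LinearMap.mem_range]
  constructor
  · rintro ⟨_, ⟨x, rfl⟩, rfl⟩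
    exact ⟨e x, (h x).symm⟩
  · rintro ⟨y, rfl⟩
    obtain ⟨x, rfl⟩ := e.surjective y
    exact ⟨_, ⟨x, rfl⟩, h x⟩

theorem range_pow_succ_le (T : X →L[𝕜] X) (n : ℕ) : (T ^ (n + 1)).range ≤ (T ^ n).range := by
  rintro _ ⟨y, rfl⟩
  exact ⟨T y, by rw [pow_succ]; rfl⟩

theorem range_pow_antitone (T : X →L[𝕜] X) : Antitone fun n => (T ^ n).range :=
  antitone_nat_of_succ_le (range_pow_succ_le T)

theorem apply_mem_range_pow_succ (T : X →L[𝕜] X) (n : ℕ) :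
    ∀ x ∈ (T ^ n).range, T x ∈ (T ^ (n + 1)).range := by
  rintro _ ⟨y, rfl⟩
  exact ⟨y, by rw [pow_succ']; rfl⟩

/-- With `ι` the inclusion of `R(T^(n+1))` in `R(T^n)` and `σ` the surjection `T : R(T^n) →
R(T^(n+1))`, the two restrictions are `ι ∘ σ` and `σ ∘ ι`. -/
theorem exists_erank_restrictRange_succ (T : X →L[𝕜] X) (n : ℕ) :
    ∃ a : ℕ∞, erank 𝕜 (restrictRange T n).ker = a + erank 𝕜 (restrictRange T (n + 1)).ker ∧
      erank 𝕜 (_ ⧸ (restrictRange T n).range) =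
        a + erank 𝕜 (_ ⧸ (restrictRange T (n + 1)).range) := by
  refine exists_erank_comp_swap (Submodule.inclusion (range_pow_succ_le T n))
    ((T : X →ₗ[𝕜] X).restrict (apply_mem_range_pow_succ T n)) (Submodule.inclusion_injective _) ?_
  rintro ⟨_, y, rfl⟩
  exact ⟨⟨(T ^ n) y, y, rfl⟩, Subtype.ext (DFunLike.congr_fun (pow_succ' T n).symm y)⟩

theorem exists_erank_restrictRange_of_le (T : X →L[𝕜] X) {n m : ℕ} (h : n ≤ m) :
    ∃ a : ℕ∞, erank 𝕜 (restrictRange T n).ker = a + erank 𝕜 (restrictRange T m).ker ∧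
      erank 𝕜 (_ ⧸ (restrictRange T n).range) =
        a + erank 𝕜 (_ ⧸ (restrictRange T m).range) := by
  induction m, h using Nat.le_induction with
  | base => exact ⟨0, by simp, by simp⟩
  | succ m _ ih =>
    obtain ⟨a, h1, h2⟩ := ih
    obtain ⟨b, h3, h4⟩ := exists_erank_restrictRange_succ T m
    exact ⟨a + b, by rw [h1, h3, add_assoc], by rw [h2, h4, add_assoc]⟩

theorem fredholmIndex_restrictRange_eq (T : X →L[𝕜] X) {n m : ℕ} (h : n ≤ m)
    (hn : erank 𝕜 (restrictRange T n).ker ≠ ⊤ ∨ erank 𝕜 (_ ⧸ (restrictRange T n).range) ≠ ⊤) :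
    fredholmIndex (restrictRange T n) = fredholmIndex (restrictRange T m) := by
  obtain ⟨a, h1, h2⟩ := exists_erank_restrictRange_of_le T h
  rw [fredholmIndex_eq_ediff, fredholmIndex_eq_ediff, h1, h2, ediff_add_left]
  -- An infinite excess would make both nullity and defect at `n` infinite.
  rintro rfl
  simp [h1, h2] at hn

theorem exists_equiv_range_pow_zero (T : X →L[𝕜] X) :
    ∃ e : X ≃ₗ[𝕜] (T ^ 0).range, ∀ x, e (T x) = restrictRange T 0 (e x) :=
  ⟨(LinearEquiv.ofTop _ (LinearMap.range_eq_top.2 fun x => ⟨x, rfl⟩)).symm, fun _ => rfl⟩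

end Index

/-! ### Stable iteration -/

section Stable

variable {𝕜 : Type*} [RCLike 𝕜] {X : Type*} [NormedAddCommGroup X] [NormedSpace 𝕜 X]

theorem pow_add_apply (T : X →L[𝕜] X) (m n : ℕ) (x : X) : (T ^ (m + n)) x = (T ^ m) ((T ^ n) x) :=
  DFunLike.congr_fun (pow_add T m n) x

theorem pow_succ_apply (T : X →L[𝕜] X) (n : ℕ) (x : X) : (T ^ (n + 1)) x = (T ^ n) (T x) :=
  DFunLike.congr_fun (pow_succ T n) x

theorem pow_succ_apply' (T : X →L[𝕜] X) (n : ℕ) (x : X) : (T ^ (n + 1)) x = T ((T ^ n) x) :=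
  DFunLike.congr_fun (pow_succ' T n) x

theorem coe_restrict_pow_apply {T : X →L[𝕜] X} {M : Submodule 𝕜 X} (hM : ∀ x ∈ M, T x ∈ M) (n : ℕ)
    (x : M) : ((T.restrict hM ^ n) x : X) = (T ^ n) x := by
  induction n generalizing x with
  | zero => rfl
  | succ n ih => rw [pow_succ_apply, pow_succ_apply, ih]; rfl

theorem ker_pow_monotone (T : X →L[𝕜] X) : Monotone fun n => (T ^ n).ker :=
  monotone_nat_of_le_succ fun n x (hx : (T ^ n) x = 0) => by
    change (T ^ (n + 1)) x = 0
    rw [pow_succ_apply', hx, map_zero]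

theorem dis_eq_sInf {T : X →L[𝕜] X} (h : (stableSet T).Nonempty) :
    dis T = (sInf (stableSet T) : ℕ) :=
  le_antisymm (iInf₂_le _ (Nat.sInf_mem h))
    (le_iInf₂ fun _ hn => Nat.cast_le.2 (Nat.sInf_le hn))

theorem mem_stableSet_of_dis_eq {T : X →L[𝕜] X} {d : ℕ} (h : dis T = d) : d ∈ stableSet T := by
  rcases (stableSet T).eq_empty_or_nonempty with he | hne
  · simp [dis, he] at h
  · rw [dis_eq_sInf hne, Nat.cast_inj] at h
    exact h ▸ Nat.sInf_mem hne

theorem mem_stableSet_of_le {T : X →L[𝕜] X} {n m : ℕ} (hn : n ∈ stableSet T) (h : n ≤ m) :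
    m ∈ stableSet T := fun k hk => (hn m h).symm.trans (hn k (h.trans hk))

/-- Both equalities say `N(T^(n+1)) ⊆ R(T) + N(T^n)`: indeed `N(T) ∩ R(T^n) = T^n N(T^(n+1))`, and
`T^n x ∈ R(T^(n+1))` exactly when `x ∈ R(T) + N(T^n)`. -/
theorem ker_inf_range_succ_eq_iff (T : X →L[𝕜] X) (n : ℕ) :
    T.ker ⊓ (T ^ n).range = T.ker ⊓ (T ^ (n + 1)).range ↔
      T.range ⊔ (T ^ n).ker = T.range ⊔ (T ^ (n + 1)).ker := by
  constructor
  · intro h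
    refine le_antisymm (sup_le_sup_left (ker_pow_monotone T n.le_succ) _) (sup_le le_sup_left ?_)
    intro x hx
    have hx : (T ^ (n + 1)) x = 0 := hx
    have h1 : (T ^ n) x ∈ T.ker ⊓ (T ^ n).range :=
      ⟨by change T _ = 0; rw [← pow_succ_apply', hx], x, rfl⟩
    rw [h] at h1
    obtain ⟨y, hy⟩ := h1.2
    have hy : (T ^ (n + 1)) y = (T ^ n) x := hy
    refine Submodule.mem_sup.2 ⟨T y, ⟨y, rfl⟩, x - T y, ?_, by abel⟩
    change (T ^ n) (x - T y) = 0
    rw [map_sub, ← pow_succ_apply, hy, sub_self]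
  · intro h
    refine le_antisymm ?_ (inf_le_inf_left _ (range_pow_succ_le T n))
    rintro _ ⟨hx, x, rfl⟩
    have hx : T ((T ^ n) x) = 0 := hx
    have h1 : x ∈ T.range ⊔ (T ^ (n + 1)).ker :=
      Submodule.mem_sup_right (by change (T ^ (n + 1)) x = 0; rw [pow_succ_apply', hx])
    rw [← h] at h1
    obtain ⟨_, ⟨u, rfl⟩, v, hv, rfl⟩ := Submodule.mem_sup.1 h1
    have hv : (T ^ n) v = 0 := hv
    refine ⟨hx, u, ?_⟩
    change (T ^ (n + 1)) u = (T ^ n) (T u + v)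
    rw [map_add, hv, add_zero, pow_succ_apply]

theorem mem_stableSet_iff_range_sup_ker {T : X →L[𝕜] X} {n : ℕ} :
    n ∈ stableSet T ↔ ∀ m, n ≤ m → T.range ⊔ (T ^ n).ker = T.range ⊔ (T ^ m).ker := by
  constructor
  · intro h m hm
    induction m, hm using Nat.le_induction with
    | base => rfl
    | succ m hm ih =>
      rw [ih, ← ker_inf_range_succ_eq_iff]
      exact mem_stableSet_of_le h hm _ m.le_succ
  · intro h m hm
    induction m, hm using Nat.le_induction with
    | base => rfl
    | succ m hm ih =>
      rw [ih, ker_inf_range_succ_eq_iff]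
      exact (h m hm).symm.trans (h (m + 1) (hm.trans m.le_succ))

theorem ker_pow_le_range_sup_ker {T : X →L[𝕜] X} {n : ℕ} (hn : n ∈ stableSet T) (m : ℕ) :
    (T ^ m).ker ≤ T.range ⊔ (T ^ n).ker := by
  rw [mem_stableSet_iff_range_sup_ker.1 hn (max n m) (le_max_left _ _)]
  exact (ker_pow_monotone T (le_max_right n m)).trans le_sup_right

end Stable

/-! ### Complemented subspaces and operator ranges -/

section Complemented

variable {𝕜 : Type*} [RCLike 𝕜] {X : Type*} [NormedAddCommGroup X] [NormedSpace 𝕜 X]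
  {E : Type*} [NormedAddCommGroup E] [NormedSpace 𝕜 E]

/-- The map `E × G → X`, `(e, g) ↦ f e + g`, is a bounded surjection of Banach spaces, hence a
quotient map, and the preimage of the range of `f` is `{g = 0}`. -/
theorem isClosed_range_of_isCompl [CompleteSpace E] [CompleteSpace X] (f : E →L[𝕜] X)
    {G : Submodule 𝕜 X} (h : IsCompl f.range G) (hG : IsClosed (G : Set X)) :
    IsClosed (f.range : Set X) := by
  have : CompleteSpace G := hG.completeSpace_coe
  have hs : Function.Surjective (f.coprod G.subtypeL) := by
    rw [← ContinuousLinearMap.coe_coe, ← LinearMap.range_eq_top]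
    simp [LinearMap.range_coprod, h.sup_eq_top]
  rw [← ((f.coprod G.subtypeL).isQuotientMap hs).isClosed_preimage]
  have : (f.coprod G.subtypeL) ⁻¹' (f.range : Set X) = {p | p.2 = 0} := by
    ext ⟨e, g⟩
    have h0 : f e + g ∈ f.range ↔ (g : X) ∈ f.range :=
      Submodule.add_mem_iff_right _ ⟨e, rfl⟩
    have h1 : (g : X) ∈ f.range ↔ g = 0 := by
      refine ⟨fun hg => ?_, fun hg => by simp [hg]⟩
      have := Submodule.disjoint_def.1 h.disjoint g hg g.2
      exact Subtype.ext this
    exact h0.trans h1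
  rw [this]
  exact isClosed_eq continuous_snd continuous_const

theorem isClosed_range_of_finiteDimensional_quotient [CompleteSpace E] [CompleteSpace X]
    (f : E →L[𝕜] X) [FiniteDimensional 𝕜 (X ⧸ f.range)] : IsClosed (f.range : Set X) := by
  obtain ⟨G, hG⟩ := f.range.exists_isCompl
  have : FiniteDimensional 𝕜 G := (Submodule.quotientEquivOfIsCompl _ _ hG).finiteDimensional
  exact isClosed_range_of_isCompl f hG G.closed_of_finiteDimensional

theorem closedComplemented_of_proj {p : Submodule 𝕜 X} (f : X →L[𝕜] X) (h1 : ∀ x, f x ∈ p)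
    (h2 : ∀ x ∈ p, f x = x) : p.ClosedComplemented :=
  ⟨f.codRestrict p h1, fun x => Subtype.ext (h2 x x.2)⟩

theorem _root_.Submodule.ClosedComplemented.exists_proj {p : Submodule 𝕜 X}
    (h : p.ClosedComplemented) : ∃ f : X →L[𝕜] X, (∀ x, f x ∈ p) ∧ ∀ x ∈ p, f x = x := by
  obtain ⟨f, hf⟩ := h
  exact ⟨p.subtypeL ∘L f, fun x => (f x).2, fun x hx => congrArg Subtype.val (hf ⟨x, hx⟩)⟩

theorem closedComplemented_comap_subtype {p M : Submodule 𝕜 X} (h : p.ClosedComplemented)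
    (hp : p ≤ M) : (p.comap M.subtype).ClosedComplemented := by
  obtain ⟨f, h1, h2⟩ := h.exists_proj
  exact closedComplemented_of_proj ((f ∘L M.subtypeL).codRestrict M fun x => hp (h1 x))
    (fun x => h1 x) fun x hx => Subtype.ext (h2 x hx)

theorem closedComplemented_map_subtype {M : Submodule 𝕜 X} {p : Submodule 𝕜 M}
    (h : p.ClosedComplemented) (hM : M.ClosedComplemented) :
    (p.map M.subtype).ClosedComplemented := by
  obtain ⟨f, h1, h2⟩ := h.exists_proj
  obtain ⟨g, hg⟩ := hM
  refine closedComplemented_of_proj (M.subtypeL ∘L f ∘L g) (fun x => ⟨_, h1 (g x), rfl⟩) ?_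
  rintro _ ⟨x, hx, rfl⟩
  change ((f (g x) : M) : X) = x
  rw [hg, h2 x hx]

/-- If `p` projects onto `A`, `q = 1 - p`, and `r` projects onto the finite-dimensional `q B`, then
`p + r q` projects onto `A + q B = A + B`. -/
theorem closedComplemented_sup_finiteDimensional {A B : Submodule 𝕜 X}
    (hA : A.ClosedComplemented) [FiniteDimensional 𝕜 B] : (A ⊔ B).ClosedComplemented := by
  obtain ⟨p, hp1, hp2⟩ := hA.exists_proj
  set q : X →L[𝕜] X := ContinuousLinearMap.id 𝕜 X - p with hq
  have hqx : ∀ x, q x = x - p x := fun x => rfl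
  have hqq : ∀ x, q (q x) = q x := fun x => by
    rw [hqx (q x), hqx x, map_sub, hp2 _ (hp1 x), sub_self, sub_zero]
  obtain ⟨r, hr1, hr2⟩ :=
    (Submodule.ClosedComplemented.of_finiteDimensional (𝕜 := 𝕜) (B.map q.toLinearMap)).exists_proj
  have hqB : B.map q.toLinearMap ≤ A ⊔ B := by
    rintro _ ⟨b, hb, rfl⟩
    exact Submodule.sub_mem _ (Submodule.mem_sup_right hb) (Submodule.mem_sup_left (hp1 b))
  refine closedComplemented_of_proj (p + r ∘L q)
    (fun x => Submodule.add_mem _ (Submodule.mem_sup_left (hp1 x)) (hqB (hr1 _))) fun x hx => ?_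
  have hx' : q x ∈ B.map q.toLinearMap := by
    obtain ⟨a, ha, b, hb, rfl⟩ := Submodule.mem_sup.1 hx
    refine ⟨b, hb, ?_⟩
    change q b = q (a + b)
    rw [map_add, hqx a, hp2 a ha, sub_self, zero_add]
  change p x + r (q x) = x
  rw [hr2 _ hx', hqx, add_sub_cancel]

end Complemented

/-! ### Kato decomposition -/

section Kato

universe u
variable {𝕜 : Type*} [RCLike 𝕜] {X : Type u} [NormedAddCommGroup X] [NormedSpace 𝕜 X]

/-- The subspace `Z + T Z + ⋯ + T ^ (k - 1) Z + R(T ^ k)`. -/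
def orbitSum (T : X →L[𝕜] X) (Z : Submodule 𝕜 X) : ℕ → Submodule 𝕜 X
  | 0 => ⊤
  | k + 1 => Z ⊔ (orbitSum T Z k).map T.toLinearMap

theorem orbitSum_succ_le (T : X →L[𝕜] X) (Z : Submodule 𝕜 X) (k : ℕ) :
    orbitSum T Z (k + 1) ≤ orbitSum T Z k := by
  induction k with
  | zero => exact le_top
  | succ k ih => exact sup_le_sup_left (Submodule.map_mono ih) _

theorem apply_mem_orbitSum (T : X →L[𝕜] X) (Z : Submodule 𝕜 X) (k : ℕ) :
    ∀ x ∈ orbitSum T Z k, T x ∈ orbitSum T Z k := by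
  intro x hx
  cases k with
  | zero => trivial
  | succ k => exact Submodule.mem_sup_right ⟨x, orbitSum_succ_le T Z k hx, rfl⟩

theorem range_pow_le_orbitSum (T : X →L[𝕜] X) (Z : Submodule 𝕜 X) (k : ℕ) :
    (T ^ k).range ≤ orbitSum T Z k := by
  induction k with
  | zero => exact le_top
  | succ k ih =>
    rintro _ ⟨x, rfl⟩
    exact Submodule.mem_sup_right ⟨(T ^ k) x, ih ⟨x, rfl⟩, (pow_succ_apply' T k x).symm⟩

/-- A sum of closed subspaces and images need not be closed; being an operator range is enough for
`isClosed_range_of_isCompl`. -/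
theorem orbitSum_eq_range (T : X →L[𝕜] X) {Z : Submodule 𝕜 X} [CompleteSpace X] [CompleteSpace Z]
    (k : ℕ) : ∃ (E : Type u) (_ : NormedAddCommGroup E) (_ : NormedSpace 𝕜 E) (_ : CompleteSpace E)
      (f : E →L[𝕜] X), f.range = orbitSum T Z k := by
  induction k with
  | zero => exact ⟨X, _, _, ‹_›, ContinuousLinearMap.id 𝕜 X, LinearMap.range_id⟩
  | succ k ih =>
    obtain ⟨E, _, _, _, f, hf⟩ := ih
    refine ⟨Z × E, inferInstance, inferInstance, inferInstance, Z.subtypeL.coprod (T ∘L f), ?_⟩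
    rw [orbitSum, ← hf, ContinuousLinearMap.coe_coprod, LinearMap.range_coprod,
      ContinuousLinearMap.toLinearMap_comp, LinearMap.range_comp]
    simp

theorem orbitSum_sup_ker_pow (T : X →L[𝕜] X) {Z : Submodule 𝕜 X} {d : ℕ}
    (hZ : T.range ⊔ (T ^ d).ker ⊔ Z = ⊤) (k : ℕ) : orbitSum T Z k ⊔ (T ^ d).ker = ⊤ := by
  induction k with
  | zero => exact top_sup_eq _
  | succ k ih =>
    rw [eq_top_iff, ← hZ]
    refine sup_le (sup_le ?_ le_sup_right) (le_sup_left.trans' le_sup_left)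
    rintro _ ⟨x, rfl⟩
    obtain ⟨y, hy, v, hv, rfl⟩ := Submodule.mem_sup.1 (ih.symm ▸ Submodule.mem_top : x ∈ _)
    have hv : (T ^ d) v = 0 := hv
    refine Submodule.mem_sup.2 ⟨T y, Submodule.mem_sup_right ⟨y, hy, rfl⟩, T v, ?_,
      (map_add T y v).symm⟩
    change (T ^ d) (T v) = 0
    rw [← pow_succ_apply, pow_succ_apply', hv, map_zero]

/-- By stability `N(T^m) ⊆ R(T) + N(T^d)`, which misses `Z`, so an element `z + T y` of the
intersection has `z = 0`. Then `y` lies in `N(T^(m+1))`, which is why `m` varies in the induction.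
-/
theorem orbitSum_inf_ker_pow_le (T : X →L[𝕜] X) {Z : Submodule 𝕜 X} {d : ℕ}
    (hd : d ∈ stableSet T) (hZ : Disjoint (T.range ⊔ (T ^ d).ker) Z) (k m : ℕ) :
    orbitSum T Z k ⊓ (T ^ m).ker ≤ (T ^ k).range := by
  induction k generalizing m with
  | zero => exact fun x _ => ⟨x, rfl⟩
  | succ k ih =>
    rintro x ⟨hx, hm⟩
    obtain ⟨z, hz, _, ⟨y, hy, rfl⟩, rfl⟩ := Submodule.mem_sup.1 hx
    have hz0 : z = 0 := by
      refine Submodule.disjoint_def.1 hZ z ?_ hz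
      have h1 := Submodule.sub_mem _ (ker_pow_le_range_sup_ker hd m hm)
        (Submodule.mem_sup_left (⟨y, rfl⟩ : T y ∈ T.range))
      change z + T y - T y ∈ _ at h1
      rwa [add_sub_cancel_right] at h1
    subst hz0
    rw [zero_add] at hm ⊢
    obtain ⟨w, hw⟩ := ih (m + 1) ⟨hy, (pow_succ_apply T m y).trans hm⟩
    have hw : (T ^ k) w = y := hw
    exact ⟨w, by change (T ^ (k + 1)) w = T y; rw [pow_succ_apply', hw]⟩

/-- The largest `T`-invariant subspace of `N(T ^ d)` that is annihilated by `P`. -/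
def nilPart (T P : X →L[𝕜] X) (d : ℕ) : Submodule 𝕜 X :=
  (T ^ d).ker ⊓ ⨅ j : ℕ, ⨅ _ : j < d, (P ∘L T ^ j).ker

theorem mem_nilPart {T P : X →L[𝕜] X} {d : ℕ} {x : X} :
    x ∈ nilPart T P d ↔ (T ^ d) x = 0 ∧ ∀ j < d, P ((T ^ j) x) = 0 := by
  simp only [nilPart, Submodule.mem_inf, Submodule.mem_iInf]
  rfl

theorem isClosed_nilPart (T P : X →L[𝕜] X) (d : ℕ) : IsClosed (nilPart T P d : Set X) := by
  simp only [nilPart, Submodule.coe_inf, Submodule.coe_iInf]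
  exact (T ^ d).isClosed_ker.inter
    (isClosed_iInter fun j => isClosed_iInter fun _ => (P ∘L T ^ j).isClosed_ker)

theorem apply_mem_nilPart (T P : X →L[𝕜] X) (d : ℕ) :
    ∀ x ∈ nilPart T P d, T x ∈ nilPart T P d := by
  intro x hx
  rw [mem_nilPart] at hx ⊢
  refine ⟨by rw [← pow_succ_apply, pow_succ_apply', hx.1, map_zero], fun j hj => ?_⟩
  rw [← pow_succ_apply]
  rcases (Nat.succ_le_of_lt hj).lt_or_eq with h | h
  · exact hx.2 _ h
  · rw [show j + 1 = d from h, hx.1, map_zero]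

variable {T P : X →L[𝕜] X} {d : ℕ}

/-- The conditions `P T^j (x - g) = 0` are achieved from `j = d - 1` downwards. The correction `g'`
at level `i` satisfies `T^i g' = P T^i (x - g)` and hence `T^(i+1) g' = 0`, so it does not disturb
the levels above. -/
theorem ker_pow_le_sup_nilPart (hd : d ∈ stableSet T) (hP : ∀ x, P x ∈ T.ker ⊓ (T ^ d).range)
    (hP' : ∀ x ∈ T.ker ⊓ (T ^ d).range, P x = x) :
    (T ^ d).ker ≤ (T ^ d).range ⊔ nilPart T P d := by
  have key : ∀ k ≤ d, ∀ x, (T ^ d) x = 0 → ∃ g ∈ (T ^ d).range, (T ^ d) g = 0 ∧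
      ∀ j < d, d ≤ j + k → P ((T ^ j) (x - g)) = 0 := by
    intro k
    induction k with
    | zero => exact fun _ x _ => ⟨0, zero_mem _, map_zero _, fun j h1 h2 => by omega⟩
    | succ k ih =>
      intro hk x hx
      obtain ⟨g, hg, hg0, h⟩ := ih (by omega) x hx
      obtain ⟨i, rfl⟩ : ∃ i, d = i + k + 1 := ⟨d - (k + 1), by omega⟩
      have hf := hP ((T ^ i) (x - g))
      -- Stability puts the values of `P` in `R(T^(d+i))`, so that `g'` can be chosen in `R(T^d)`.
      rw [hd (i + k + 1 + i) (by omega)] at hf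
      obtain ⟨hf0, w, hw⟩ := hf
      have hf0 : T (P ((T ^ i) (x - g))) = 0 := hf0
      have hw : (T ^ (i + k + 1 + i)) w = P ((T ^ i) (x - g)) := hw
      set g' := (T ^ (i + k + 1)) w with hg'
      have h1 : (T ^ i) g' = P ((T ^ i) (x - g)) := by
        rw [hg', ← pow_add_apply, ← hw, add_comm]
      have h2 : ∀ l, (T ^ (l + (i + 1))) g' = 0 := fun l => by
        rw [pow_add_apply, pow_succ_apply', h1, hf0, map_zero]
      refine ⟨g + g', add_mem hg ⟨w, rfl⟩, ?_, fun j hj1 hj2 => ?_⟩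
      · rw [map_add, hg0, zero_add]
        have := h2 k
        rwa [show k + (i + 1) = i + k + 1 by omega] at this
      · rw [← sub_sub, map_sub, map_sub]
        rcases Nat.lt_or_ge i j with hij | hij
        · obtain ⟨l, rfl⟩ : ∃ l, j = l + (i + 1) := ⟨j - (i + 1), by omega⟩
          rw [h2, map_zero, sub_zero]
          exact h _ hj1 (by omega)
        · obtain rfl : j = i := by omega
          rw [h1, hP' _ (hP _), sub_self]
  intro x hx
  obtain ⟨g, hg, hg0, h⟩ := key d le_rfl x hx
  have hx : (T ^ d) x = 0 := hx
  refine Submodule.mem_sup.2 ⟨g, hg, x - g, mem_nilPart.2 ⟨?_, fun j hj => h j hj (by omega)⟩,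
    add_sub_cancel _ _⟩
  rw [map_sub, hx, hg0, sub_zero]

/-- Descending in the exponent: if `T^(e+1) x = 0`, then `T^e x` lies in `N(T) ∩ R(T^d)`, where `P`
is the identity, while `P T^e x = 0`. -/
theorem disjoint_range_pow_nilPart (hP' : ∀ x ∈ T.ker ⊓ (T ^ d).range, P x = x) :
    Disjoint (T ^ d).range (nilPart T P d) := by
  refine Submodule.disjoint_def.2 fun x hx hN => ?_
  rw [mem_nilPart] at hN
  have key : ∀ k ≤ d, (T ^ (d - k)) x = 0 := by
    intro k
    induction k with
    | zero => exact fun _ => hN.1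
    | succ k ih =>
      intro hk
      have h1 := ih (by omega)
      rw [show d - k = d - (k + 1) + 1 by omega, pow_succ_apply'] at h1
      obtain ⟨w, hw⟩ := hx
      have hw : (T ^ d) w = x := hw
      rw [← hP' ((T ^ (d - (k + 1))) x) ⟨h1, (T ^ (d - (k + 1))) w, ?_⟩]
      · exact hN.2 _ (by omega)
      · change (T ^ d) _ = _
        rw [← hw, ← pow_add_apply, ← pow_add_apply, add_comm]
  simpa using key d le_rfl

/-- Kato decomposition of an operator with stable iteration from `d` on, for which
`N(T) ∩ R(T ^ d)` and `R(T) + N(T ^ d)` are complemented. -/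
theorem exists_kato_decomposition [CompleteSpace X] (hd : d ∈ stableSet T) (hd1 : 1 ≤ d)
    (hF : (T.ker ⊓ (T ^ d).range).ClosedComplemented)
    (hE : (T.range ⊔ (T ^ d).ker).ClosedComplemented) :
    ∃ (M N : Submodule 𝕜 X) (h : Reduces T M N), IsNilpotent (T.restrict h.map_right) ∧
      T.ker ⊓ (T ^ d).range ≤ M ∧
      (T.restrict h.map_left).ker = (T.ker ⊓ (T ^ d).range).comap M.subtype ∧
      (T.restrict h.map_left).range = (T.range ⊔ (T ^ d).ker).comap M.subtype ∧
      (T.restrict h.map_left).range.ClosedComplemented := by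
  obtain ⟨P, hP, hP'⟩ := hF.exists_proj
  obtain ⟨Z, hZc, hZ⟩ := hE.exists_isClosed_isCompl
  have : CompleteSpace Z := hZc.completeSpace_coe
  have hMR : (T ^ d).range ≤ orbitSum T Z d := range_pow_le_orbitSum T Z d
  have hMN : ∀ m, orbitSum T Z d ⊓ (T ^ m).ker ≤ (T ^ d).range :=
    orbitSum_inf_ker_pow_le T hd hZ.disjoint d
  have hNK : nilPart T P d ≤ (T ^ d).ker := inf_le_left
  have hc : IsCompl (orbitSum T Z d) (nilPart T P d) := by
    constructor
    · refine Submodule.disjoint_def.2 fun x hM hN => ?_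
      exact Submodule.disjoint_def.1 (disjoint_range_pow_nilPart hP') x (hMN d ⟨hM, hNK hN⟩) hN
    · rw [codisjoint_iff, eq_top_iff, ← orbitSum_sup_ker_pow T hZ.sup_eq_top d]
      exact sup_le le_sup_left
        ((ker_pow_le_sup_nilPart hd hP hP').trans (sup_le_sup_right hMR _))
  have hMc : IsClosed (orbitSum T Z d : Set X) := by
    obtain ⟨E, _, _, _, f, hf⟩ := orbitSum_eq_range T (Z := Z) d
    rw [← hf] at hc ⊢
    exact isClosed_range_of_isCompl f hc (isClosed_nilPart T P d)
  have hred : Reduces T (orbitSum T Z d) (nilPart T P d) :=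
    ⟨hMc, isClosed_nilPart T P d, hc, apply_mem_orbitSum T Z d, apply_mem_nilPart T P d⟩
  have hrange : (T.restrict hred.map_left).range =
      (T.range ⊔ (T ^ d).ker).comap (orbitSum T Z d).subtype := by
    refine le_antisymm ?_ fun x hx => ?_
    · rintro _ ⟨x, rfl⟩
      exact Submodule.mem_sup_left ⟨x, rfl⟩
    -- With `u = m + n` along `M ⊕ N`, the vector `x - T m = T n + v` lies in `M ∩ N(T^d) ⊆ R(T^d)`.
    -- As `T^d` kills `N` and `d ≥ 1`, `R(T^d) = T^d M ⊆ T M`.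
    · obtain ⟨_, ⟨u, rfl⟩, v, hv, huv⟩ := Submodule.mem_sup.1 hx
      have huv : T u + v = x := huv
      have hv : (T ^ d) v = 0 := hv
      obtain ⟨m, hm, n, hn, rfl⟩ := Submodule.mem_sup.1
        (hc.sup_eq_top.symm ▸ Submodule.mem_top : u ∈ _)
      have hn' : (T ^ d) (T n) = 0 := hNK (apply_mem_nilPart T P d n hn)
      have h1 : (x : X) - T m ∈ (T ^ d).range := by
        refine hMN d ⟨sub_mem x.2 (hred.map_left m hm), ?_⟩
        change (T ^ d) (x - T m) = 0
        rw [← huv, map_add T, show T m + T n + v - T m = T n + v by abel, map_add, hn', hv,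
          add_zero]
      obtain ⟨w, hw⟩ := h1
      have hw : (T ^ d) w = x - T m := hw
      obtain ⟨m', hm', n', hn', rfl⟩ := Submodule.mem_sup.1
        (hc.sup_eq_top.symm ▸ Submodule.mem_top : w ∈ _)
      have hn0 : (T ^ d) n' = 0 := hNK hn'
      rw [map_add, hn0, add_zero] at hw
      obtain ⟨k, rfl⟩ : ∃ k, d = k + 1 := ⟨d - 1, by omega⟩
      rw [pow_succ_apply'] at hw
      have hpow : ∀ j, (T ^ j) m' ∈ orbitSum T Z (k + 1) := fun j => by
        induction j with
        | zero => exact hm'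
        | succ j ih => rw [pow_succ_apply']; exact apply_mem_orbitSum T Z _ _ ih
      refine ⟨⟨m + (T ^ k) m', add_mem hm (hpow k)⟩, Subtype.ext ?_⟩
      change T (m + (T ^ k) m') = x
      rw [map_add, hw, add_sub_cancel]
  refine ⟨_, _, hred, ⟨d, ?_⟩, inf_le_right.trans hMR, ?_, hrange, ?_⟩
  · ext x
    rw [coe_restrict_pow_apply]
    exact hNK x.2
  · ext x
    have hk : x ∈ (T.restrict hred.map_left).ker ↔ T x = 0 := by
      rw [LinearMap.mem_ker, ← Subtype.coe_inj]; rfl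
    rw [hk]
    refine ⟨fun hx => ⟨hx, hMN 1 ⟨x.2, ?_⟩⟩, fun hx => hx.1⟩
    rw [pow_one]
    exact hx
  · rw [hrange]
    have : CompleteSpace (orbitSum T Z d) := hMc.completeSpace_coe
    -- `Z` itself lies in `M` because `d ≥ 1`, and complements the range there.
    refine Submodule.ClosedComplemented.of_isCompl_isClosed (q := Z.comap (orbitSum T Z d).subtype)
      ⟨?_, ?_⟩ (hE.isClosed.preimage continuous_subtype_val)
      (hZc.preimage continuous_subtype_val)
    · refine Submodule.disjoint_def.2 fun x h1 h2 => Subtype.ext ?_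
      exact Submodule.disjoint_def.1 hZ.disjoint x h1 h2
    · have hZM : Z ≤ orbitSum T Z d := by
        obtain ⟨k, rfl⟩ : ∃ k, d = k + 1 := ⟨d - 1, by omega⟩
        exact le_sup_left
      rw [codisjoint_iff, eq_top_iff]
      intro x _
      obtain ⟨e, he, z, hz, hez⟩ := Submodule.mem_sup.1
        (hZ.sup_eq_top.symm ▸ Submodule.mem_top : (x : X) ∈ T.range ⊔ (T ^ d).ker ⊔ Z)
      refine Submodule.mem_sup.2 ⟨x - ⟨z, hZM hz⟩, ?_, ⟨z, hZM hz⟩, hz, sub_add_cancel _ _⟩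
      change (x : X) - z ∈ T.range ⊔ (T ^ d).ker
      rwa [← hez, add_sub_cancel_right]

end Kato

/-! ### Powers of semi-Fredholm operators -/

section SemiFredholm

variable {𝕜 : Type*} [RCLike 𝕜] {X : Type*} [NormedAddCommGroup X] [NormedSpace 𝕜 X]

theorem finiteDimensional_ker_pow {S : X →L[𝕜] X} [FiniteDimensional 𝕜 S.ker] (n : ℕ) :
    FiniteDimensional 𝕜 (S ^ n).ker := by
  induction n with
  | zero =>
    have : (S ^ 0).ker = ⊥ := LinearMap.ker_id
    rw [this]
    infer_instance
  | succ n ih =>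
    refine Module.Finite.iff_fg.2 (Submodule.fg_of_fg_map_of_fg_inf_ker S.toLinearMap ?_ ?_)
    · have hle : (S ^ (n + 1)).ker.map S.toLinearMap ≤ (S ^ n).ker := by
        rintro _ ⟨x, hx, rfl⟩
        exact (pow_succ_apply S n x).symm.trans hx
      exact Module.Finite.iff_fg.1 (Submodule.finiteDimensional_of_le hle)
    · exact Module.Finite.iff_fg.1 (Submodule.finiteDimensional_inf_right _ S.ker)

theorem finiteDimensional_quotient_iff {V : Type*} [AddCommGroup V] [Module 𝕜 V]
    {p : Submodule 𝕜 V} :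
    FiniteDimensional 𝕜 (V ⧸ p) ↔ ∃ Z : Submodule 𝕜 V, FiniteDimensional 𝕜 Z ∧ p ⊔ Z = ⊤ := by
  constructor
  · intro _
    obtain ⟨Z, hZ⟩ := p.exists_isCompl
    exact ⟨Z, (Submodule.quotientEquivOfIsCompl _ _ hZ).finiteDimensional, hZ.sup_eq_top⟩
  · rintro ⟨Z, _, hZ⟩
    refine Module.Finite.of_surjective (p.mkQ ∘ₗ Z.subtype) ?_
    rw [← LinearMap.range_eq_top, LinearMap.range_comp, Submodule.range_subtype,
      ← Submodule.comap_injective_of_surjective p.mkQ_surjective |>.eq_iff, Submodule.comap_map_mkQ,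
      hZ, Submodule.comap_top]

theorem finiteDimensional_quotient_range_pow {S : X →L[𝕜] X} [FiniteDimensional 𝕜 (X ⧸ S.range)]
    (n : ℕ) : FiniteDimensional 𝕜 (X ⧸ (S ^ n).range) := by
  rw [finiteDimensional_quotient_iff]
  induction n with
  | zero => exact ⟨⊥, inferInstance, by rw [sup_bot_eq]; exact LinearMap.range_id⟩
  | succ n ih =>
    obtain ⟨Z, _, hZ⟩ := ih
    obtain ⟨Z', _, hZ'⟩ := finiteDimensional_quotient_iff.1 ‹FiniteDimensional 𝕜 (X ⧸ S.range)›
    refine ⟨Z.map S.toLinearMap ⊔ Z', inferInstance, ?_⟩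
    have h1 : (S ^ (n + 1)).range = (S ^ n).range.map S.toLinearMap := by
      rw [← LinearMap.range_comp]
      exact congrArg (fun f : X →L[𝕜] X => f.range) (pow_succ' S n)
    rw [h1, ← sup_assoc, ← Submodule.map_sup, hZ, Submodule.map_top, hZ']

/-- Onto its closed range `S` is a quotient map, and the preimage of `S W` is `W + N(S)`, closed
because `N(S)` is finite-dimensional. -/
theorem IsUpperSemiFredholm.isClosed_map [CompleteSpace X] {S : X →L[𝕜] X}
    (hS : IsUpperSemiFredholm S) {W : Submodule 𝕜 X} (hW : IsClosed (W : Set X)) :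
    IsClosed (W.map S.toLinearMap : Set X) := by
  have : CompleteSpace S.range := hS.isClosed_range.completeSpace_coe
  have := hS.finite_ker
  let f : X →L[𝕜] S.range := S.codRestrict S.range fun x => ⟨x, rfl⟩
  have hf : Function.Surjective f := by
    rintro ⟨_, x, rfl⟩
    exact ⟨x, rfl⟩
  have h1 : IsClosed ((W.map S.toLinearMap).comap S.range.subtype : Set S.range) := by
    rw [← (f.isQuotientMap hf).isClosed_preimage]
    have h2 : f ⁻¹' ((W.map S.toLinearMap).comap S.range.subtype : Set S.range) =
        (W ⊔ S.ker : Submodule 𝕜 X) := by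
      rw [← Submodule.comap_map_eq]
      rfl
    rw [h2]
    exact Submodule.isClosed_sup_finiteDimensional _ _ hW
  have h3 := hS.isClosed_range.isClosedEmbedding_subtypeVal.isClosedMap _ h1
  have h4 : (W.map S.toLinearMap : Set X) =
      Subtype.val '' ((W.map S.toLinearMap).comap S.range.subtype : Set S.range) := by
    ext x
    constructor
    · rintro ⟨w, hw, rfl⟩
      exact ⟨⟨S w, w, rfl⟩, ⟨w, hw, rfl⟩, rfl⟩
    · rintro ⟨y, hy, rfl⟩
      exact hy
  rw [h4]
  exact h3

theorem IsUpperSemiFredholm.isClosed_range_pow [CompleteSpace X] {S : X →L[𝕜] X}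
    (hS : IsUpperSemiFredholm S) (n : ℕ) : IsClosed ((S ^ n).range : Set X) := by
  induction n with
  | zero =>
    have : (S ^ 0).range = ⊤ := LinearMap.range_id
    rw [this]
    exact isClosed_univ
  | succ n ih =>
    have : (S ^ (n + 1)).range = (S ^ n).range.map S.toLinearMap := by
      rw [← LinearMap.range_comp]
      exact congrArg (fun f : X →L[𝕜] X => f.range) (pow_succ' S n)
    rw [this]
    exact hS.isClosed_map ih

theorem IsLowerSemiFredholm.isClosed_range_pow [CompleteSpace X] {S : X →L[𝕜] X}
    (hS : IsLowerSemiFredholm S) (n : ℕ) : IsClosed ((S ^ n).range : Set X) := by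
  have := hS.finite_coker
  have := finiteDimensional_quotient_range_pow (S := S) n
  exact isClosed_range_of_finiteDimensional_quotient (S ^ n)

theorem nonempty_stableSet_of_finiteDimensional_ker (S : X →L[𝕜] X) [FiniteDimensional 𝕜 S.ker] :
    (stableSet S).Nonempty := by
  obtain ⟨n, hn⟩ := IsArtinian.monotone_stabilizes (R := 𝕜) (M := S.ker)
    ⟨fun n => OrderDual.toDual ((S ^ n).range.comap S.ker.subtype),
      fun _ _ h => Submodule.comap_mono (range_pow_antitone S h)⟩
  refine ⟨n, fun m hm => ?_⟩
  have h1 : (S ^ n).range.comap S.ker.subtype = (S ^ m).range.comap S.ker.subtype := hn m hm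
  rw [← Submodule.map_comap_subtype, h1, Submodule.map_comap_subtype]

/-- The images of `N(S^n)` in the finite-dimensional `X / R(S)` increase, hence stabilize. -/
theorem nonempty_stableSet_of_finiteDimensional_coker (S : X →L[𝕜] X)
    [FiniteDimensional 𝕜 (X ⧸ S.range)] : (stableSet S).Nonempty := by
  obtain ⟨n, hn⟩ := monotone_stabilizes_iff_noetherian.2
    (inferInstance : IsNoetherian 𝕜 (X ⧸ S.range))
    ⟨fun n => (S ^ n).ker.map S.range.mkQ, fun _ _ h => Submodule.map_mono (ker_pow_monotone S h)⟩
  refine ⟨n, mem_stableSet_iff_range_sup_ker.2 fun m hm => ?_⟩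
  have h1 : (S ^ n).ker.map S.range.mkQ = (S ^ m).ker.map S.range.mkQ := hn m hm
  rw [← Submodule.comap_map_mkQ, h1, Submodule.comap_map_mkQ]

/-- `A / (A ∩ B)` embeds in `X / B`, so `A ∩ B` is closed of finite codimension in `A`. -/
theorem closedComplemented_inf_of_finiteDimensional_quotient {A B : Submodule 𝕜 X}
    (hA : A.ClosedComplemented) (hB : IsClosed (B : Set X)) [FiniteDimensional 𝕜 (X ⧸ B)] :
    (A ⊓ B).ClosedComplemented := by
  have : FiniteDimensional 𝕜 (A ⧸ B.comap A.subtype) := by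
    refine Module.Finite.of_injective ((B.comap A.subtype).mapQ B A.subtype le_rfl) ?_
    rw [← LinearMap.ker_eq_bot, Submodule.mapQ, Submodule.ker_liftQ_eq_bot]
    rw [LinearMap.ker_comp, Submodule.ker_mkQ]
  rw [← Submodule.map_comap_subtype]
  exact closedComplemented_map_subtype
    (.of_finiteDimensional_quotient (hB.preimage continuous_subtype_val)) hA

end SemiFredholm

/-! ### Reducing pairs, B-Fredholm properties and the index -/

section Reduction

universe u
variable {𝕜 : Type*} [RCLike 𝕜] {X : Type u} [NormedAddCommGroup X] [NormedSpace 𝕜 X]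
  {T : X →L[𝕜] X} {M N : Submodule 𝕜 X}

theorem Reduces.exists_add (h : Reduces T M N) (x : X) : ∃ m ∈ M, ∃ n ∈ N, m + n = x :=
  Submodule.mem_sup.1 (h.isCompl.sup_eq_top.symm ▸ Submodule.mem_top)

theorem Reduces.exists_le_ker_pow (h : Reduces T M N) (hN : IsNilpotent (T.restrict h.map_right)) :
    ∃ p, ∀ m, p ≤ m → N ≤ (T ^ m).ker := by
  obtain ⟨p, hp⟩ := hN
  refine ⟨p, fun m hm => le_trans (fun x hx => ?_) (ker_pow_monotone T hm)⟩
  change (T ^ p) x = 0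
  rw [← coe_restrict_pow_apply h.map_right p ⟨x, hx⟩, hp]
  rfl

theorem Reduces.range_pow_eq (h : Reduces T M N) {m : ℕ} (hm : N ≤ (T ^ m).ker) :
    (T ^ m).range = (T.restrict h.map_left ^ m).range.map M.subtype := by
  ext x
  constructor
  · rintro ⟨x, rfl⟩
    obtain ⟨a, ha, b, hb, rfl⟩ := h.exists_add x
    have hb : (T ^ m) b = 0 := hm hb
    refine ⟨_, ⟨⟨a, ha⟩, rfl⟩, (coe_restrict_pow_apply h.map_left m ⟨a, ha⟩).trans ?_⟩
    change (T ^ m) a = (T ^ m) (a + b)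
    rw [map_add, hb, add_zero]
  · rintro ⟨_, ⟨a, rfl⟩, rfl⟩
    exact ⟨a, (coe_restrict_pow_apply h.map_left m a).symm⟩

theorem Reduces.ker_inf_range_pow_eq (h : Reduces T M N) {m : ℕ} (hm : N ≤ (T ^ m).ker) :
    T.ker ⊓ (T ^ m).range =
      ((T.restrict h.map_left).ker ⊓ (T.restrict h.map_left ^ m).range).map M.subtype := by
  rw [h.range_pow_eq hm]
  ext x
  constructor
  · rintro ⟨hx, y, hy, rfl⟩
    exact ⟨y, ⟨Subtype.ext hx, hy⟩, rfl⟩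
  · rintro ⟨y, ⟨hy, hy'⟩, rfl⟩
    exact ⟨congrArg Subtype.val hy, y, hy', rfl⟩

theorem Reduces.range_sup_ker_pow_eq (h : Reduces T M N) {m : ℕ} (hm : N ≤ (T ^ m).ker) :
    T.range ⊔ (T ^ m).ker =
      ((T.restrict h.map_left).range ⊔ (T.restrict h.map_left ^ m).ker).map M.subtype ⊔ N := by
  refine le_antisymm (sup_le ?_ ?_) (sup_le ?_ (hm.trans le_sup_right))
  · rintro _ ⟨x, rfl⟩
    obtain ⟨a, ha, b, hb, rfl⟩ := h.exists_add x
    refine Submodule.mem_sup.2 ⟨T a, ?_, T b, h.map_right b hb, (map_add T a b).symm⟩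
    exact ⟨_, Submodule.mem_sup_left ⟨⟨a, ha⟩, rfl⟩, rfl⟩
  · intro x hx
    have hx : (T ^ m) x = 0 := hx
    obtain ⟨a, ha, b, hb, rfl⟩ := h.exists_add x
    have hb' : (T ^ m) b = 0 := hm hb
    rw [map_add, hb', add_zero] at hx
    refine Submodule.mem_sup.2 ⟨a, ⟨⟨a, ha⟩, Submodule.mem_sup_right (Subtype.ext ?_), rfl⟩, b, hb,
      rfl⟩
    exact (coe_restrict_pow_apply h.map_left m ⟨a, ha⟩).trans hx
  · rw [Submodule.map_sup]
    refine sup_le_sup ?_ ?_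
    · rintro _ ⟨_, ⟨a, rfl⟩, rfl⟩
      exact ⟨a, rfl⟩
    · rintro _ ⟨a, ha, rfl⟩
      exact (coe_restrict_pow_apply h.map_left m a).symm.trans (congrArg Subtype.val ha)

/-- `dis T` may be too small for `T^d` to kill `N`; stability allows `d` to be replaced by a larger
`m` that does, without changing the two subspaces in the definitions. -/
theorem Reduces.exists_mem_stableSet (h : Reduces T M N)
    (hN : IsNilpotent (T.restrict h.map_right))
    (hM : (stableSet (T.restrict h.map_left)).Nonempty) :
    ∃ d m : ℕ, dis T = d ∧ N ≤ (T ^ m).ker ∧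
      T.ker ⊓ (T ^ d).range = T.ker ⊓ (T ^ m).range ∧
      T.range ⊔ (T ^ d).ker = T.range ⊔ (T ^ m).ker := by
  obtain ⟨p, hp⟩ := h.exists_le_ker_pow hN
  obtain ⟨n, hn⟩ := hM
  have hne : (stableSet T).Nonempty := by
    refine ⟨max n p, fun m hm => ?_⟩
    rw [h.ker_inf_range_pow_eq (hp _ (le_max_right n p)),
      h.ker_inf_range_pow_eq (hp m ((le_max_right n p).trans hm)),
      ← hn (max n p) (le_max_left _ _), ← hn m ((le_max_left n p).trans hm)]
  have hd := Nat.sInf_mem hne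
  exact ⟨_, max (sInf (stableSet T)) p, dis_eq_sInf hne, hp _ (le_max_right _ _),
    hd _ (le_max_left _ _), mem_stableSet_iff_range_sup_ker.1 hd _ (le_max_left _ _)⟩

theorem isClosed_range_restrictRange {n : ℕ} (hn : IsClosed ((T ^ (n + 1)).range : Set X)) :
    IsClosed ((restrictRange T n).range : Set (T ^ n).range) := by
  have : ((restrictRange T n).range : Set (T ^ n).range) =
      Subtype.val ⁻¹' ((T ^ (n + 1)).range : Set X) := by
    ext ⟨_, x, rfl⟩
    constructor
    · rintro ⟨⟨_, y, rfl⟩, hy⟩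
      exact ⟨y, (pow_succ_apply' T n y).trans (congrArg Subtype.val hy)⟩
    · rintro ⟨y, hy⟩
      exact ⟨⟨(T ^ n) y, y, rfl⟩, Subtype.ext ((pow_succ_apply' T n y).symm.trans hy)⟩
  rw [this]
  exact hn.preimage continuous_subtype_val

variable [CompleteSpace X]

theorem Reduces.closedComplemented_left (h : Reduces T M N) : M.ClosedComplemented :=
  .of_isCompl_isClosed h.isCompl h.isClosed_left h.isClosed_right

theorem Reduces.closedComplemented_map_sup (h : Reduces T M N) {A : Submodule 𝕜 M}
    (hA : A.ClosedComplemented) : (A.map M.subtype ⊔ N).ClosedComplemented := by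
  obtain ⟨f, hf1, hf2⟩ := hA.exists_proj
  have ht : Submodule.IsTopCompl M N := Submodule.IsCompl.isTopCompl_of_isClosed h.isCompl h.isClosed_left
    h.isClosed_right
  set q := M.projectionOntoL N ht with hq
  have hqM : ∀ x : M, q x = x := Submodule.projectionOntoL_apply_left ht
  have hqN : ∀ x : X, q x = 0 ↔ x ∈ N := fun x => Submodule.projectionOntoL_apply_eq_zero_iff ht
  refine closedComplemented_of_proj
    -- The projection onto `A` applied to the `M`-component, plus the `N`-component.
    (M.subtypeL ∘L f ∘L q + (ContinuousLinearMap.id 𝕜 X - M.subtypeL ∘L q)) (fun x => ?_)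
    fun x hx => ?_
  · refine Submodule.add_mem_sup ⟨_, hf1 (q x), rfl⟩ ((hqN _).1 ?_)
    change q (x - (q x : X)) = 0
    rw [map_sub, hqM, sub_self]
  · change (f (q x) : X) + (x - (q x : X)) = x
    obtain ⟨_, ⟨a, ha, rfl⟩, b, hb, rfl⟩ := Submodule.mem_sup.1 hx
    have h1 : q (M.subtype a + b) = a := by
      rw [map_add, (hqN b).2 hb, add_zero]
      exact hqM a
    rw [h1, hf2 a ha, add_sub_cancel]

theorem Reduces.isLeftBFredholm (h : Reduces T M N)
    (hM : IsLeftEssInvertible (T.restrict h.map_left))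
    (hN : IsNilpotent (T.restrict h.map_right)) : IsLeftBFredholm T := by
  have := hM.upper.finite_ker
  obtain ⟨d, m, hd, hm, h1, h2⟩ :=
    h.exists_mem_stableSet hN (nonempty_stableSet_of_finiteDimensional_ker _)
  refine ⟨d, hd, ?_, ?_⟩
  · rw [h1, h.ker_inf_range_pow_eq hm]
    infer_instance
  · rw [h2, h.range_sup_ker_pow_eq hm]
    have := finiteDimensional_ker_pow (S := T.restrict h.map_left) m
    exact h.closedComplemented_map_sup (closedComplemented_sup_finiteDimensional hM.compl_range)

theorem Reduces.isRightBFredholm (h : Reduces T M N)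
    (hM : IsRightEssInvertible (T.restrict h.map_left))
    (hN : IsNilpotent (T.restrict h.map_right)) : IsRightBFredholm T := by
  have := hM.lower.finite_coker
  have : CompleteSpace M := h.isClosed_left.completeSpace_coe
  obtain ⟨d, m, hd, hm, h1, h2⟩ :=
    h.exists_mem_stableSet hN (nonempty_stableSet_of_finiteDimensional_coker _)
  have hfin : FiniteDimensional 𝕜 (X ⧸ (T.range ⊔ (T ^ d).ker)) := by
    rw [h2]
    obtain ⟨Z, _, hZ⟩ := finiteDimensional_quotient_iff.1 hM.lower.finite_coker
    refine finiteDimensional_quotient_iff.2 ⟨Z.map M.subtype, inferInstance, ?_⟩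
    rw [h.range_sup_ker_pow_eq hm, eq_top_iff, ← h.isCompl.sup_eq_top]
    refine sup_le ?_ (le_sup_right.trans le_sup_left)
    have h3 : M = (T.restrict h.map_left).range.map M.subtype ⊔ Z.map M.subtype := by
      rw [← Submodule.map_sup, hZ, Submodule.map_top, Submodule.range_subtype]
    refine h3.le.trans (sup_le_sup_right ((Submodule.map_mono le_sup_left).trans le_sup_left) _)
  refine ⟨d, hd, ?_, hfin, ?_⟩
  -- The sum is the range of a bounded operator on `X × N(T^d)`, so finite codimension makes it
  -- closed.
  · have : CompleteSpace (T ^ d).ker := (T ^ d).isClosed_ker.completeSpace_coe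
    have h3 : (T.coprod (T ^ d).ker.subtypeL).range = T.range ⊔ (T ^ d).ker := by
      rw [ContinuousLinearMap.coe_coprod, LinearMap.range_coprod]
      simp
    rw [← h3] at hfin ⊢
    exact isClosed_range_of_finiteDimensional_quotient _
  · rw [h1, h.ker_inf_range_pow_eq hm]
    have := finiteDimensional_quotient_range_pow (S := T.restrict h.map_left) m
    exact closedComplemented_map_subtype (closedComplemented_inf_of_finiteDimensional_quotient
      hM.compl_ker (hM.lower.isClosed_range_pow m)) h.closedComplemented_left

theorem IsLeftBFredholm.exists_reduces (hT : IsLeftBFredholm T) :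
    ∃ (M N : Submodule 𝕜 X) (h : Reduces T M N),
      IsLeftEssInvertible (T.restrict h.map_left) ∧ IsNilpotent (T.restrict h.map_right) := by
  obtain ⟨d, hd, hF, hE⟩ := hT
  have hd := mem_stableSet_of_dis_eq hd
  -- The Kato decomposition needs a positive exponent, and `dis T` may be `0`; `d + 1` gives the
  -- same subspaces.
  rw [hd _ d.le_succ] at hF
  rw [mem_stableSet_iff_range_sup_ker.1 hd _ d.le_succ] at hE
  obtain ⟨M, N, h, hN, hFM, hk, hr, hc⟩ := exists_kato_decomposition
    (mem_stableSet_of_le hd d.le_succ) d.succ_pos (.of_finiteDimensional _) hE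
  refine ⟨M, N, h, ⟨⟨hc.isClosed, ?_⟩, hc⟩, hN⟩
  rw [hk]
  exact (Submodule.comapSubtypeEquivOfLe hFM).symm.finiteDimensional

theorem IsRightBFredholm.exists_reduces (hT : IsRightBFredholm T) :
    ∃ (M N : Submodule 𝕜 X) (h : Reduces T M N),
      IsRightEssInvertible (T.restrict h.map_left) ∧ IsNilpotent (T.restrict h.map_right) := by
  obtain ⟨d, hd, hE, hE', hF⟩ := hT
  have hd := mem_stableSet_of_dis_eq hd
  rw [hd _ d.le_succ] at hF
  rw [mem_stableSet_iff_range_sup_ker.1 hd _ d.le_succ] at hE hE'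
  obtain ⟨M, N, h, hN, hFM, hk, hr, hc⟩ := exists_kato_decomposition
    (mem_stableSet_of_le hd d.le_succ) d.succ_pos hF (.of_finiteDimensional_quotient hE)
  refine ⟨M, N, h, ⟨⟨?_⟩, ?_⟩, hN⟩
  · rw [hr]
    refine Module.Finite.of_injective (Submodule.mapQ _ _ M.subtype le_rfl) ?_
    rw [← LinearMap.ker_eq_bot, Submodule.mapQ, Submodule.ker_liftQ_eq_bot]
    rw [LinearMap.ker_comp, Submodule.ker_mkQ]
  · rw [hk]
    exact closedComplemented_comap_subtype hF hFM

/-- For `m ≥ p` the restrictions of `T` to `R(T^m)` and of `S = T|_M` to `R(S^m)` are conjugate. The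
index is carried from `n` up to `max n p` for `T`, across, and down to `0` for `S`. -/
theorem Reduces.hasBFredholmIndex (h : Reduces T M N)
    (hM : IsUpperSemiFredholm (T.restrict h.map_left) ∨ IsLowerSemiFredholm (T.restrict h.map_left))
    (hN : IsNilpotent (T.restrict h.map_right)) :
    HasBFredholmIndex T (fredholmIndex (T.restrict h.map_left)) := by
  have : CompleteSpace M := h.isClosed_left.completeSpace_coe
  obtain ⟨p, hp⟩ := h.exists_le_ker_pow hN
  set S := T.restrict h.map_left with hS
  have hequiv : ∀ m, p ≤ m → ∃ e : (S ^ m).range ≃ₗ[𝕜] (T ^ m).range,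
      ∀ x, e (restrictRange S m x) = restrictRange T m (e x) := fun m hm =>
    ⟨((S ^ m).range.equivMapOfInjective M.subtype M.injective_subtype).trans
      (LinearEquiv.ofEq _ _ (h.range_pow_eq (hp m hm)).symm), fun _ => rfl⟩
  obtain ⟨e₀, he₀⟩ := exists_equiv_range_pow_zero S
  have hk0 := erank_ker_congr e₀ he₀
  have hc0 := erank_coker_congr e₀ he₀
  have hfin : erank 𝕜 S.ker ≠ ⊤ ∨ erank 𝕜 (M ⧸ S.range) ≠ ⊤ :=
    hM.imp (fun h => erank_ne_top_iff.2 h.finite_ker) fun h => erank_ne_top_iff.2 h.finite_coker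
  have hclosed : ∀ m, p ≤ m → IsClosed ((T ^ m).range : Set X) := fun m hm => by
    rw [h.range_pow_eq (hp m hm)]
    exact h.isClosed_left.isClosedEmbedding_subtypeVal.isClosedMap _
      (hM.elim (fun h => h.isClosed_range_pow m) fun h => h.isClosed_range_pow m)
  refine ⟨⟨p, hclosed p le_rfl, ?_⟩, fun n hn => ?_⟩
  · obtain ⟨e, he⟩ := hequiv p le_rfl
    -- Nullity and defect of `S` on `R(S^p)` are at most those of `S`, so finiteness is inherited.
    obtain ⟨a, h1, h2⟩ := exists_erank_restrictRange_of_le S p.zero_le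
    refine hM.imp (fun hM => ⟨isClosed_range_restrictRange (hclosed _ p.le_succ), ?_⟩)
      fun hM => ⟨?_⟩
    · rw [← erank_ne_top_iff, ← erank_ker_congr e he]
      intro htop
      rw [← hk0, htop, add_top] at h1
      exact erank_ne_top_iff.2 hM.finite_ker h1
    · rw [← erank_ne_top_iff, ← erank_coker_congr e he]
      intro htop
      rw [← hc0, htop, add_top] at h2
      exact erank_ne_top_iff.2 hM.finite_coker h2
  · obtain ⟨e, he⟩ := hequiv (max n p) (le_max_right _ _)
    rw [fredholmIndex_restrictRange_eq T (le_max_left n p) (hn.2.imp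
      (fun h => erank_ne_top_iff.2 h.finite_ker) fun h => erank_ne_top_iff.2 h.finite_coker)]
    have h1 : fredholmIndex (restrictRange S (max n p)) = fredholmIndex (restrictRange T (max n p)) :=
      congrArg₂ ediff (erank_ker_congr e he) (erank_coker_congr e he)
    have h2 : fredholmIndex S = fredholmIndex (restrictRange S 0) := congrArg₂ ediff hk0 hc0
    rw [hk0, hc0] at hfin
    rw [← h1, h2]
    exact (fredholmIndex_restrictRange_eq S (max n p).zero_le hfin).symm

end Reduction

end BFredholm

theorem theoremC1 {𝕜 : Type*} [RCLike 𝕜] {X : Type*} [NormedAddCommGroup X] [NormedSpace 𝕜 X]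
    [CompleteSpace X] (T : X →L[𝕜] X) :
    ((BFredholm.IsLeftBFredholm T ↔
        ∃ (M N : Submodule 𝕜 X) (h : BFredholm.Reduces T M N),
          BFredholm.IsLeftEssInvertible (T.restrict h.map_left) ∧
          IsNilpotent (T.restrict h.map_right)) ∧
      ∀ (M N : Submodule 𝕜 X) (h : BFredholm.Reduces T M N),
        BFredholm.IsLeftEssInvertible (T.restrict h.map_left) →
        IsNilpotent (T.restrict h.map_right) →
        BFredholm.HasBFredholmIndex T (BFredholm.fredholmIndex (T.restrict h.map_left))) ∧
    ((BFredholm.IsRightBFredholm T ↔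
        ∃ (M N : Submodule 𝕜 X) (h : BFredholm.Reduces T M N),
          BFredholm.IsRightEssInvertible (T.restrict h.map_left) ∧
          IsNilpotent (T.restrict h.map_right)) ∧
      ∀ (M N : Submodule 𝕜 X) (h : BFredholm.Reduces T M N),
        BFredholm.IsRightEssInvertible (T.restrict h.map_left) →
        IsNilpotent (T.restrict h.map_right) →
        BFredholm.HasBFredholmIndex T (BFredholm.fredholmIndex (T.restrict h.map_left))) := by
  exact ⟨⟨⟨fun hT => hT.exists_reduces, fun ⟨_, _, h, hM, hN⟩ => h.isLeftBFredholm hM hN⟩,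
      fun _ _ h hM hN => h.hasBFredholmIndex (Or.inl hM.upper) hN⟩,
    ⟨fun hT => hT.exists_reduces, fun ⟨_, _, h, hM, hN⟩ => h.isRightBFredholm hM hN⟩,
      fun _ _ h hM hN => h.hasBFredholmIndex (Or.inr hM.lower) hN⟩
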